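/- Let $(s_n)_{n\ge0}$ and $(t_n)_{n\ge0}$ be sequences of real numbers with $t_n\ne0$ for all $n$, and suppose that $s_i=s$ and $t_i=t$ for all $i\ge1$. Consider Motzkin paths, that is, lattice paths in $\mathbb Z^2$ that start at $(0,0)$, consist of up-steps $(1,1)$, horizontal steps $(1,0)$ and down-steps $(1,-1)$, and never run below the $x$-axis. An up-step has weight $1$, a horizontal step on height $h$ has weight $s_h$, a down-step ending on height $h$ has weight $t_h$, and the weight of a path is the product of the weights of its steps. Let $m_n$ denote the sum of the weights of all such paths from $(0,0)$ to $(n,0)$. Let $\alpha,\beta,\gamma$ be indeterminates or, more generally, elements of a commutative $\mathbb R$-algebra $A$ (for indeterminates, $A=\mathbb R[\alpha,\beta,\gamma]$; for real numbers, $A=\mathbb R$), and for $n\ge1$ put $$D_n=t_0^{-(n-1)}\,t^{-\binom{n-1}{2}}\det\bigl(\alpha\beta\gamma\, m_{i+j}+(\alpha\beta+\beta\gamma+\gamma\alpha)\,m_{i+j+1}+(\alpha+\beta+\gamma)\,m_{i+j+2}+m_{i+j+3}\bigr)_{i,j=0}^{n-1}.$$ Then $(D_n)_{n\ge1}$ satisfies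 a linear recurrence of order $8$ with constant coefficients: there are $c_0,\dots,c_7\in A$, independent of $n$ and with $c_0$ invertible in $A$ (in particular $c_0\neq0$ if $A\ne0$), such that $$D_{n+8}=c_7D_{n+7}+c_6D_{n+6}+\cdots+c_0D_n\qquad\text{for all }n\ge1.$$ -/

import Mathlib

namespace MotzkinHankel

/-- The height reached after the first `j` steps of the lattice path starting at height `0` whose
`i`-th step changes the height by `p i ∈ {1, 0, -1}` (up-step, horizontal step, down-step). -/
def height {n : ℕ} (p : Fin n → SignType) (j : ℕ) : ℤ :=
  ∑ i ∈ Finset.univ.filter (fun i : Fin n => (i : ℕ) < j), (p i : ℤ)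

/-- The path never runs below the horizontal axis. -/
def IsMotzkin {n : ℕ} (p : Fin n → SignType) : Prop :=
  ∀ j : Fin (n + 1), 0 ≤ height p j

instance {n : ℕ} (p : Fin n → SignType) : Decidable (IsMotzkin p) :=
  inferInstanceAs (Decidable (∀ j : Fin (n + 1), 0 ≤ height p j))

/-- The weight of the `i`-th step: an up-step has weight `1`, a horizontal step on height `h` has
weight `s h`, and a down-step which ends on height `h` has weight `t h`. In all cases the step ends
on height `height p (i + 1)`, which is nonnegative for a Motzkin path. -/
def stepWeight {R : Type*} [CommRing R] (s t : ℕ → R) {n : ℕ} (p : Fin n → SignType)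
    (i : Fin n) : R :=
  match p i with
  | SignType.pos => 1
  | SignType.zero => s (height p (i + 1)).toNat
  | SignType.neg => t (height p (i + 1)).toNat

/-- `m(n,k)`: the sum of the weights of all Motzkin paths from `(0,0)` to `(n,k)`, the weight of a
path being the product of the weights of its steps. -/
def pathGF {R : Type*} [CommRing R] (s t : ℕ → R) (n k : ℕ) : R :=
  ∑ p : Fin n → SignType with IsMotzkin p ∧ height p n = (k : ℤ), ∏ i, stepWeight s t p i

/-- `m_n = m(n,0)`. -/
def moment {R : Type*} [CommRing R] (s t : ℕ → R) (n : ℕ) : R :=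
  pathGF s t n 0

/-- The determinant of the `n × n` matrix, `0 ≤ i, j ≤ n - 1`, with entries
`αβγ m_{i+j} + (αβ+βγ+γα) m_{i+j+1} + (α+β+γ) m_{i+j+2} + m_{i+j+3}`, for real weights `s`, `t`
and elements `α`, `β`, `γ` of a commutative real algebra. -/
noncomputable def fourTermHankel {A : Type*} [CommRing A] [Algebra ℝ A] (s t : ℕ → ℝ)
    (α β γ : A) (n : ℕ) : A :=
  Matrix.det (Matrix.of fun i j : Fin n =>
    α * β * γ * algebraMap ℝ A (moment s t (i + j))
      + (α * β + β * γ + γ * α) * algebraMap ℝ A (moment s t (i + j + 1))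
      + (α + β + γ) * algebraMap ℝ A (moment s t (i + j + 2))
      + algebraMap ℝ A (moment s t (i + j + 3)))

/-- The determinant above, scaled by `t₀^{-(n-1)} τ^{-binom(n-1,2)}`, for `n ≥ 1`. -/
noncomputable def scaledFourTermHankel {A : Type*} [CommRing A] [Algebra ℝ A] (s t : ℕ → ℝ)
    (τ : ℝ) (α β γ : A) (n : ℕ) : A :=
  ((t 0 ^ (n - 1))⁻¹ * (τ ^ (n - 1).choose 2)⁻¹) • fourTermHankel s t α β γ n

/-- The sequence `(D n)_{n ≥ 1}` satisfies a linear recurrence of order `d` with constant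
coefficients: `D (n+d) = c_{d-1} D (n+d-1) + ⋯ + c_0 D n` for all `n ≥ 1`, with coefficients `c_k`
that do not depend on `n` and with `c_0` invertible (over a field: `c_0 ≠ 0`). -/
def SatisfiesLinearRecurrence {A : Type*} [CommRing A] (d : ℕ) (D : ℕ → A) : Prop :=
  ∃ c : ℕ → A, IsUnit (c 0) ∧
    ∀ n : ℕ, 1 ≤ n → D (n + d) = ∑ k ∈ Finset.range d, c k * D (n + k)

end MotzkinHankel

/-! Let `L` be the functional with moments `m_n`. The determinant is the Hankel determinant of `L`
multiplied by the cubic with roots `-α, -β, -γ`. Christoffel's formula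
(`det_hankel_mul_det_vandermonde`) turns it, up to sign and a Vandermonde factor, into a product of
weights, which the scaling cancels, times a 3 × 3 determinant of values of the orthogonal
polynomials at these roots.

From degree 1 on, these values satisfy second-order recurrences with constant coefficients, one for
each root. Each term of the 3 × 3 determinant is thus a product of three solutions, which is
annihilated by the characteristic polynomial, of degree `2 ^ 3 = 8`, of a Kronecker product of
companion matrices (`sum_charpoly_mul_det`).

Cancelling the Vandermonde factor needs distinct roots in a domain, so the recurrence is proved for
indeterminates and then specialised. -/

namespace MotzkinHankel

/-! ### Path weights: recurrences from removing the last step -/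

section Paths

variable {n : ℕ} (q : Fin n → SignType) (e : SignType)

theorem height_snoc_of_le {j : ℕ} (hj : j ≤ n) :
    height (Fin.snoc q e : Fin (n + 1) → SignType) j = height q j := by
  simp [height, Finset.sum_filter, Fin.sum_univ_castSucc, not_lt.mpr hj]

theorem height_snoc_succ :
    height (Fin.snoc q e : Fin (n + 1) → SignType) (n + 1) = height q n + (e : ℤ) := by
  simp only [height, Finset.sum_filter, Fin.sum_univ_castSucc]
  congr 1
  · refine Finset.sum_congr rfl fun i _ => ?_
    have := i.isLt
    simp [this, this.trans (Nat.lt_succ_self n)]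
  · simp

theorem isMotzkin_snoc :
    IsMotzkin (Fin.snoc q e : Fin (n + 1) → SignType) ↔
      IsMotzkin q ∧ 0 ≤ height q n + (e : ℤ) := by
  unfold IsMotzkin
  rw [Fin.forall_fin_succ']
  refine and_congr (forall_congr' fun j => ?_) ?_
  · rw [Fin.val_castSucc, height_snoc_of_le q e (Nat.lt_succ_iff.mp j.isLt)]
  · rw [Fin.val_last, height_snoc_succ]

theorem stepWeight_snoc_castSucc {R : Type*} [CommRing R] (s t : ℕ → R) (i : Fin n) :
    stepWeight s t (Fin.snoc q e : Fin (n + 1) → SignType) i.castSucc = stepWeight s t q i := by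
  have h : height (Fin.snoc q e : Fin (n + 1) → SignType) (i + 1) = height q (i + 1) :=
    height_snoc_of_le q e i.isLt
  simp [stepWeight, h]

theorem stepWeight_snoc_last {R : Type*} [CommRing R] (s t : ℕ → R) :
    stepWeight s t (Fin.snoc q e : Fin (n + 1) → SignType) (Fin.last n) =
      match e with
      | SignType.pos => 1
      | SignType.zero => s (height q n).toNat
      | SignType.neg => t (height q n - 1).toNat := by
  unfold stepWeight
  simp only [Fin.snoc_last, Fin.val_last, height_snoc_succ]
  cases e <;> simp [← sub_eq_add_neg]

theorem pathGF_eq_sum_ite {R : Type*} [CommRing R] (s t : ℕ → R) (n k : ℕ) :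
    pathGF s t n k = ∑ p : Fin n → SignType,
      if IsMotzkin p ∧ height p n = (k : ℤ) then ∏ i, stepWeight s t p i else 0 :=
  Finset.sum_filter _ _

theorem pathGF_zero {R : Type*} [CommRing R] (s t : ℕ → R) (k : ℕ) :
    pathGF s t 0 k = if k = 0 then 1 else 0 := by
  rw [pathGF_eq_sum_ite]
  simp [IsMotzkin, height, eq_comm]

theorem pathGF_succ {R : Type*} [CommRing R] (s t : ℕ → R) (n k : ℕ) :
    pathGF s t (n + 1) k =
      (∑ q : Fin n → SignType, if IsMotzkin q ∧ height q n + 1 = (k : ℤ) then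
        ∏ i, stepWeight s t q i else 0) + s k * pathGF s t n k + t k * pathGF s t n (k + 1) := by
  simp only [pathGF_eq_sum_ite]
  rw [← (Fin.snocEquiv fun _ : Fin (n + 1) => SignType).sum_comp, Fintype.sum_prod_type,
    Finset.mul_sum, Finset.mul_sum, ← Finset.sum_add_distrib, ← Finset.sum_add_distrib,
    Finset.sum_comm]
  refine Finset.sum_congr rfl fun q _ => ?_
  -- The three choices of last step give the three summands.
  have hnn : IsMotzkin q → 0 ≤ height q n := fun h => by simpa using h (Fin.last n)
  have huniv : (Finset.univ : Finset SignType) = {SignType.pos, SignType.zero, SignType.neg} := by decide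
  rw [huniv, Finset.sum_insert (by decide), Finset.sum_insert (by decide), Finset.sum_singleton]
  simp only [Fin.snocEquiv, Equiv.coe_fn_mk, isMotzkin_snoc, height_snoc_succ,
    Fin.prod_univ_castSucc, stepWeight_snoc_castSucc, stepWeight_snoc_last, mul_one, ← add_assoc,
    mul_ite, mul_zero]
  congr 1
  · congr 1
    · refine if_congr ?_ rfl rfl
      have : ((SignType.pos : SignType) : ℤ) = 1 := rfl
      rw [this]
      constructor
      · rintro ⟨⟨h, _⟩, h'⟩; exact ⟨h, h'⟩
      · rintro ⟨h, h'⟩; exact ⟨⟨h, by omega⟩, h'⟩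
    · have : ((SignType.zero : SignType) : ℤ) = 0 := rfl
      rw [this]
      by_cases h : IsMotzkin q ∧ height q n = (k : ℤ)
      · rw [if_pos h, if_pos ⟨⟨h.1, by omega⟩, by omega⟩, h.2]
        simp [mul_comm]
      · rw [if_neg h, if_neg]
        rintro ⟨⟨h1, _⟩, h'⟩
        exact h ⟨h1, by omega⟩
  · have : ((SignType.neg : SignType) : ℤ) = -1 := rfl
    rw [this]
    by_cases h : IsMotzkin q ∧ height q n = ((k + 1 : ℕ) : ℤ)
    · rw [if_pos h, if_pos ⟨⟨h.1, by omega⟩, by omega⟩, h.2]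
      simp [mul_comm]
    · rw [if_neg h, if_neg]
      rintro ⟨⟨h1, _⟩, h'⟩
      exact h ⟨h1, by omega⟩

theorem pathGF_succ_zero {R : Type*} [CommRing R] (s t : ℕ → R) (n : ℕ) :
    pathGF s t (n + 1) 0 = s 0 * pathGF s t n 0 + t 0 * pathGF s t n 1 := by
  rw [pathGF_succ, Finset.sum_eq_zero, zero_add]
  intro q _
  rw [if_neg]
  rintro ⟨h, h'⟩
  have : 0 ≤ height q n := by simpa using h (Fin.last n)
  push_cast at h'
  omega

theorem pathGF_succ_succ {R : Type*} [CommRing R] (s t : ℕ → R) (n k : ℕ) :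
    pathGF s t (n + 1) (k + 1) = pathGF s t n k + s (k + 1) * pathGF s t n (k + 1)
      + t (k + 1) * pathGF s t n (k + 2) := by
  rw [pathGF_succ, pathGF_eq_sum_ite s t n k]
  congr 2
  refine Finset.sum_congr rfl fun q _ => if_congr (and_congr_right fun _ => ?_) rfl rfl
  push_cast
  omega

end Paths

theorem pathGF_of_lt {R : Type*} [CommRing R] (s t : ℕ → R) {n k : ℕ} (h : n < k) :
    pathGF s t n k = 0 := by
  induction n generalizing k with
  | zero => rw [pathGF_zero, if_neg (by omega)]
  | succ n ih =>
    obtain ⟨k, rfl⟩ : ∃ l, k = l + 1 := ⟨k - 1, by omega⟩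
    rw [pathGF_succ_succ, ih (by omega), ih (by omega), ih (by omega)]
    ring

theorem pathGF_self {R : Type*} [CommRing R] (s t : ℕ → R) (n : ℕ) : pathGF s t n n = 1 := by
  induction n with
  | zero => simp [pathGF_zero]
  | succ n ih =>
    rw [pathGF_succ_succ, ih, pathGF_of_lt s t (by omega), pathGF_of_lt s t (by omega)]
    ring


/-! ### Orthogonal polynomials and Christoffel's formula -/

section Christoffel

open Polynomial Matrix

variable {R : Type*} [CommRing R]

/-- The monic polynomials satisfying the three-term recurrence
`p (n + 2) = (X - s (n + 1)) p (n + 1) - t n p n`. -/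
noncomputable def orthPoly (s t : ℕ → R) : ℕ → R[X]
  | 0 => 1
  | 1 => X - C (s 0)
  | n + 2 => (X - C (s (n + 1))) * orthPoly s t (n + 1) - C (t n) * orthPoly s t n

theorem orthPoly_monic_and_natDegree [Nontrivial R] (s t : ℕ → R) (n : ℕ) :
    (orthPoly s t n).Monic ∧ (orthPoly s t n).natDegree = n := by
  induction n using Nat.twoStepInduction with
  | zero => simp [orthPoly]
  | one => simp [orthPoly, monic_X_sub_C]
  | more n ih ih' =>
    have hm : ((X - C (s (n + 1))) * orthPoly s t (n + 1)).Monic :=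
      (monic_X_sub_C _).mul ih'.1
    have hd : ((X - C (s (n + 1))) * orthPoly s t (n + 1)).natDegree = n + 2 := by
      rw [(monic_X_sub_C _).natDegree_mul ih'.1, ih'.2, natDegree_X_sub_C]; omega
    have hlt : (C (t n) * orthPoly s t n).natDegree <
        ((X - C (s (n + 1))) * orthPoly s t (n + 1)).natDegree := by
      rw [hd]
      exact (natDegree_C_mul_le _ _).trans_lt (by rw [ih.2]; omega)
    rw [orthPoly]
    exact ⟨hm.sub_of_left (degree_lt_degree hlt), by
      rw [natDegree_sub_eq_left_of_natDegree_lt hlt, hd]⟩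

/-- The linear functional on polynomials with prescribed moments. -/
noncomputable def momentFunctional (μ : ℕ → R) : R[X] →ₗ[R] R :=
  (basisMonomials R).constr R μ

theorem momentFunctional_X_pow (μ : ℕ → R) (n : ℕ) : momentFunctional μ (X ^ n) = μ n := by
  rw [← monomial_one_right_eq_X_pow]
  exact (basisMonomials R).constr_basis R μ n

/-- The path recurrence in `m` mirrors the three-term recurrence. As `m n k` vanishes for `n < k`,
this contains orthogonality. -/
theorem momentFunctional_X_pow_mul_orthPoly {s t : ℕ → R} {m : ℕ → ℕ → R}
    (h0 : ∀ n, m (n + 1) 0 = s 0 * m n 0 + t 0 * m n 1)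
    (h1 : ∀ n k, m (n + 1) (k + 1) = m n k + s (k + 1) * m n (k + 1) + t (k + 1) * m n (k + 2))
    (n k : ℕ) :
    momentFunctional (fun n => m n 0) (X ^ n * orthPoly s t k) =
      (∏ i ∈ Finset.range k, t i) * m n k := by
  induction k using Nat.twoStepInduction generalizing n with
  | zero => simp [orthPoly, momentFunctional_X_pow]
  | one =>
    have : X ^ n * orthPoly s t 1 = X ^ (n + 1) - s 0 • X ^ n := by
      rw [orthPoly, smul_eq_C_mul]; ring
    rw [this, map_sub, map_smul, momentFunctional_X_pow, momentFunctional_X_pow, h0]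
    simp
  | more k ih ih' =>
    have : X ^ n * orthPoly s t (k + 2) = X ^ (n + 1) * orthPoly s t (k + 1)
        - s (k + 1) • (X ^ n * orthPoly s t (k + 1)) - t k • (X ^ n * orthPoly s t k) := by
      rw [orthPoly, smul_eq_C_mul, smul_eq_C_mul]; ring
    rw [this, map_sub, map_sub, map_smul, map_smul, ih', ih', ih, h1]
    simp only [Finset.prod_range_succ, smul_eq_mul]
    ring

/-- Replacing the monomials by another graded monic basis does not change the determinant of a
family of linear functionals evaluated on the basis. -/
theorem det_linearMap_monic {ι : Type*} [Fintype ι] [DecidableEq ι] {N : ℕ} (e : ι ≃ Fin N)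
    (φ : ι → R[X] →ₗ[R] R) (f : ℕ → R[X]) (hm : ∀ j, (f j).Monic)
    (hd : ∀ j, (f j).natDegree = j) :
    (of fun i j => φ i (f (e j))).det = (of fun i j => φ i (X ^ (e j : ℕ))).det := by
  -- The change of basis is unitriangular, hence of determinant 1.
  have hmul : (of fun i j => φ i (f (e j))) = (of fun i j => φ i (X ^ (e j : ℕ))) *
      (of fun i j : Fin N => (f j).coeff i).submatrix e e := by
    ext i j
    simp only [of_apply, mul_apply, submatrix_apply]
    rw [e.sum_comp (fun k : Fin N => φ i (X ^ (k : ℕ)) * (f (e j)).coeff k),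
      Fin.sum_univ_eq_sum_range (fun k => φ i (X ^ k) * (f (e j)).coeff k) N]
    conv_lhs => rw [(f (e j)).as_sum_range_C_mul_X_pow' (n := N) (by rw [hd]; exact (e j).isLt)]
    rw [map_sum]
    refine Finset.sum_congr rfl fun k _ => ?_
    rw [← smul_eq_C_mul, map_smul, smul_eq_mul, mul_comm]
  rw [hmul, det_mul, det_submatrix_equiv_self, det_matrixOfPolynomials (fun j : Fin N => f j)
    (fun j => hd j) (fun j => hm j), mul_one]

theorem finRotate_pow_val (N k : ℕ) (i : Fin N) :
    (((finRotate N) ^ k) i : ℕ) = (i + k) % N := by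
  induction k with
  | zero => simp [Nat.mod_eq_of_lt i.isLt]
  | succ k ih =>
    have := i.neZero
    rw [pow_succ', Equiv.Perm.mul_apply, finRotate_apply, Fin.val_add, ih, Fin.val_one']
    simp [← add_assoc]

/-- Christoffel's formula: the Hankel determinant of the functional multiplied by
`∏ k, (X - x k)`, times the Vandermonde determinant of `x`, is up to sign the Hankel determinant
of the functional itself times a determinant of values of orthogonal polynomials. -/
theorem det_hankel_mul_det_vandermonde [Nontrivial R] {s t : ℕ → R} {m : ℕ → ℕ → R}
    (h0 : ∀ n, m (n + 1) 0 = s 0 * m n 0 + t 0 * m n 1)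
    (h1 : ∀ n k, m (n + 1) (k + 1) = m n k + s (k + 1) * m n (k + 1) + t (k + 1) * m n (k + 2))
    (hlt : ∀ n k, n < k → m n k = 0) (hself : ∀ n, m n n = 1) {r : ℕ} (x : Fin r → R) (n : ℕ) :
    (of fun i j : Fin n => momentFunctional (fun n => m n 0)
        (X ^ (i + j : ℕ) * ∏ k, (X - C (x k)))).det * (vandermonde x).det =
      ((-1) ^ (n + r - 1)) ^ r * ((∏ k ∈ Finset.range n, ∏ i ∈ Finset.range k, t i) *
        (of fun k j : Fin r => (orthPoly s t (n + j)).eval (x k)).det) := by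
  set L := momentFunctional (fun n => m n 0)
  set Q : R[X] := ∏ k, (X - C (x k)) with hQ
  have hQm : Q.Monic := monic_prod_of_monic _ _ fun k _ => monic_X_sub_C _
  have hQd : Q.natDegree = r := by
    rw [hQ, natDegree_prod_of_monic _ _ fun k _ => monic_X_sub_C _]
    simp
  have hQe (k : Fin r) : Q.eval (x k) = 0 := by
    rw [hQ, eval_prod]
    exact Finset.prod_eq_zero (Finset.mem_univ k) (by simp)
  -- These `n + r` functionals are evaluated on two graded monic bases. Orthogonality makes the
  -- matrix block triangular on `orthPoly`; on `f`, the multiples of `Q` vanish at every `x k`.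
  let φ : Fin n ⊕ Fin r → R[X] →ₗ[R] R :=
    Sum.elim (fun i => L.comp (LinearMap.mulLeft R (X ^ (i : ℕ)))) (fun k => leval (x k))
  let e : Fin n ⊕ Fin r ≃ Fin (n + r) := finSumFinEquiv
  let f : ℕ → R[X] := fun j => if j < r then X ^ j else X ^ (j - r) * Q
  have hfm (j : ℕ) : (f j).Monic := by
    by_cases h : j < r
    · simp [f, h]
    · simpa [f, h] using (monic_X_pow (j - r)).mul hQm
  have hfd (j : ℕ) : (f j).natDegree = j := by
    by_cases h : j < r
    · simp [f, h]
    · simp only [f, h, if_false]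
      rw [(monic_X_pow (j - r)).natDegree_mul hQm, natDegree_X_pow, hQd]
      omega
  have key := (det_linearMap_monic e φ f hfm hfd).trans
    (det_linearMap_monic e φ (orthPoly s t) (fun j => (orthPoly_monic_and_natDegree s t j).1)
      (fun j => (orthPoly_monic_and_natDegree s t j).2)).symm
  have hA : (of fun i j => φ i (orthPoly s t (e j))).det =
      (∏ k ∈ Finset.range n, ∏ i ∈ Finset.range k, t i) *
        (of fun k j : Fin r => (orthPoly s t (n + j)).eval (x k)).det := by
    have : (of fun i j => φ i (orthPoly s t (e j))) = fromBlocks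
        (of fun i j : Fin n => (∏ l ∈ Finset.range j, t l) * m i j) 0
        (of fun (k : Fin r) (j : Fin n) => (orthPoly s t j).eval (x k))
        (of fun k j : Fin r => (orthPoly s t (n + j)).eval (x k)) := by
      ext i j
      rcases i with i | i <;> rcases j with j | j
      · simp [φ, e, L, momentFunctional_X_pow_mul_orthPoly h0 h1]
      · simp [φ, e, L, momentFunctional_X_pow_mul_orthPoly h0 h1,
          hlt i (n + j) (by have := i.isLt; omega)]
      · simp [φ, e]
      · simp [φ, e]
    rw [this, det_fromBlocks_zero₁₂, det_of_isLowerTriangular]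
    · simp [hself, Fin.prod_univ_eq_prod_range (fun k => ∏ l ∈ Finset.range k, t l) n]
    · intro i j hij
      simp [hlt i j hij]
  -- Rotating the columns by `r` puts the multiples of `Q` first; this is the source of the sign.
  let ρ : Equiv.Perm (Fin n ⊕ Fin r) := (e.trans ((finRotate (n + r)) ^ r)).trans e.symm
  have hsign : Equiv.Perm.sign ρ = ((-1) ^ (n + r - 1)) ^ r := by
    rw [Equiv.Perm.sign_trans_trans_symm, map_pow, sign_finRotate]
  have hB : ((of fun i j => φ i (f (e j))).submatrix id ρ).det =
      (of fun i j : Fin n => L (X ^ (i + j : ℕ) * Q)).det * (vandermonde x).det := by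
    have : ((of fun i j => φ i (f (e j))).submatrix id ρ) = fromBlocks
        (of fun i j : Fin n => L (X ^ (i + j : ℕ) * Q))
        (of fun (i : Fin n) (j : Fin r) => L (X ^ (i : ℕ) * X ^ (j : ℕ))) 0 (vandermonde x) := by
      have hl (j : Fin n) : f (e (ρ (Sum.inl j))) = X ^ (j : ℕ) * Q := by
        have : ((e (ρ (Sum.inl j)) : Fin (n + r)) : ℕ) = j + r := by
          simp only [ρ, Equiv.trans_apply, Equiv.apply_symm_apply]
          rw [finRotate_pow_val, Nat.mod_eq_of_lt (by simp [e])]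
          simp [e]
        simp [f, this]
      have hr (j : Fin r) : f (e (ρ (Sum.inr j))) = X ^ (j : ℕ) := by
        have : ((e (ρ (Sum.inr j)) : Fin (n + r)) : ℕ) = j := by
          simp only [ρ, Equiv.trans_apply, Equiv.apply_symm_apply]
          rw [finRotate_pow_val]
          simp only [e, finSumFinEquiv_apply_right, Fin.val_natAdd]
          rw [show n + (j : ℕ) + r = j + (n + r) by ring, Nat.add_mod_right, Nat.mod_eq_of_lt]
          omega
        simp [f, this]
      ext i j
      rcases i with i | i <;> rcases j with j | j <;>
        simp [hl, hr, φ, pow_add, mul_assoc, hQe, vandermonde_apply]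
    rw [this, det_fromBlocks_zero₂₁]
  rw [← hB, det_permute', hsign, key, hA]
  push_cast
  rfl

end Christoffel

/-! ### Recurrences for products of solutions -/

section Recurrence

open Polynomial Matrix Kronecker

variable {R : Type*} [CommRing R]

/-- Cayley–Hamilton for the orbits of a matrix. -/
theorem sum_charpoly_coeff_mul_eq_zero [Nontrivial R] {ι : Type*} [Fintype ι] [DecidableEq ι]
    (K : Matrix ι ι R) (W : ℕ → ι → R) (hW : ∀ n, W (n + 1) = K *ᵥ W n) (n : ℕ) (i : ι) :
    ∑ k ∈ Finset.range (Fintype.card ι + 1), K.charpoly.coeff k * W (n + k) i = 0 := by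
  have hpow (k : ℕ) : W (n + k) = K ^ k *ᵥ W n := by
    induction k with
    | zero => simp
    | succ k ih => rw [← add_assoc, hW, ih, mulVec_mulVec, pow_succ']
  have h := congrArg (fun M => (M *ᵥ W n) i) K.aeval_self_charpoly
  rw [aeval_eq_sum_range, charpoly_natDegree_eq_dim] at h
  simp only [sum_mulVec, smul_mulVec, ← hpow, zero_mulVec, Finset.sum_apply, Pi.smul_apply,
    smul_eq_mul, Pi.zero_apply] at h
  exact h

/-- The companion matrix of the recurrence `u (n + 2) = a u (n + 1) - d u n`. -/
def companionTwo (d a : R) : Matrix (Fin 2) (Fin 2) R := !![0, 1; -d, a]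

/-- The matrix acting on the products of solutions of three recurrences of order two. -/
def companionKronecker (d : R) (a : Fin 3 → R) :
    Matrix (Fin 2 × Fin 2 × Fin 2) (Fin 2 × Fin 2 × Fin 2) R :=
  companionTwo d (a 0) ⊗ₖ (companionTwo d (a 1) ⊗ₖ companionTwo d (a 2))

/-- Up to sign this is the constant coefficient `c 0`, so it gives invertibility. -/
theorem det_companionKronecker (d : R) (a : Fin 3 → R) :
    (companionKronecker d a).det = d ^ 12 := by
  simp only [companionKronecker, det_kronecker, companionTwo, det_fin_two_of, Fintype.card_prod,
    Fintype.card_fin]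
  ring

theorem sum_charpoly_companionKronecker [Nontrivial R] (d : R) (a : Fin 3 → R)
    (u : Fin 3 → ℕ → R) (hu : ∀ i n, u i (n + 2) = a i * u i (n + 1) - d * u i n) (n : ℕ) :
    ∑ k ∈ Finset.range 9, (companionKronecker d a).charpoly.coeff k * ∏ i, u i (n + k) = 0 := by
  have h := sum_charpoly_coeff_mul_eq_zero (companionKronecker d a)
    (fun n q => u 0 (n + q.1) * (u 1 (n + q.2.1) * u 2 (n + q.2.2))) (fun n => by
      ext ⟨i, j, k⟩
      fin_cases i <;> fin_cases j <;> fin_cases k <;>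
      simp [companionKronecker, companionTwo, mulVec, dotProduct, Fintype.sum_prod_type,
        Fin.sum_univ_two, add_assoc, hu] <;> ring) n (0, 0, 0)
  simpa [Fin.prod_univ_three, mul_assoc] using h

theorem sum_charpoly_mul_det [Nontrivial R] (d : R) (a : Fin 3 → R)
    (u : Fin 3 → ℕ → R) (hu : ∀ i n, u i (n + 2) = a i * u i (n + 1) - d * u i n) (n : ℕ) :
    ∑ k ∈ Finset.range 9, (companionKronecker d a).charpoly.coeff k *
      (of fun i j : Fin 3 => u i (n + k + j)).det = 0 := by
  simp only [← det_transpose (of _), det_apply, Finset.mul_sum]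
  rw [Finset.sum_comm]
  -- Shifts of solutions are solutions, so each permutation contributes zero.
  refine Finset.sum_eq_zero fun π _ => ?_
  have h := sum_charpoly_companionKronecker d a (fun i n => u i (n + π i))
    (fun i n => by rw [add_right_comm, add_right_comm n 1, hu]) n
  simp only [transpose_apply, of_apply, mul_smul_comm]
  rw [← Finset.smul_sum, h, smul_zero]

end Recurrence


/-! ### The four-term Hankel determinant -/

section FourTerm

open Polynomial Matrix

theorem fourTermHankel_eq_det_momentFunctional {A : Type*} [CommRing A] [Algebra ℝ A]
    (s t : ℕ → ℝ) (a : Fin 3 → A) (n : ℕ) :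
    fourTermHankel s t (a 0) (a 1) (a 2) n =
      (of fun i j : Fin n => momentFunctional (fun n => algebraMap ℝ A (pathGF s t n 0))
        (X ^ (i + j : ℕ) * ∏ k, (X - C (-a k)))).det := by
  rw [fourTermHankel]
  congr 2
  ext i j
  have h : X ^ (i + j : ℕ) * ∏ k, (X - C (-a k)) =
      (a 0 * a 1 * a 2) • X ^ (i + j : ℕ)
        + (a 0 * a 1 + a 1 * a 2 + a 2 * a 0) • X ^ (i + j + 1 : ℕ)
        + (a 0 + a 1 + a 2) • X ^ (i + j + 2 : ℕ) + (X ^ (i + j + 3 : ℕ) : A[X]) := by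
    simp only [Fin.prod_univ_three, smul_eq_C_mul, C_neg, C_add, C_mul]
    ring
  rw [h]
  simp only [map_add, map_smul, momentFunctional_X_pow, smul_eq_mul, moment]

theorem map_scaledFourTermHankel {A B : Type*} [CommRing A] [Algebra ℝ A] [CommRing B]
    [Algebra ℝ B] (f : A →ₐ[ℝ] B) (s t : ℕ → ℝ) (τ : ℝ) (α β γ : A) (n : ℕ) :
    f (scaledFourTermHankel s t τ α β γ n) =
      scaledFourTermHankel s t τ (f α) (f β) (f γ) n := by
  rw [scaledFourTermHankel, scaledFourTermHankel, map_smul, fourTermHankel, fourTermHankel,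
    AlgHom.map_det]
  congr 2
  ext i j
  simp

theorem prod_range_prod_range_weights {t : ℕ → ℝ} {τ : ℝ} (ht1 : ∀ i, 1 ≤ i → t i = τ) (n : ℕ) :
    ∏ k ∈ Finset.range (n + 1), ∏ i ∈ Finset.range k, t i = t 0 ^ n * τ ^ n.choose 2 := by
  induction n with
  | zero => simp
  | succ n ih =>
    rw [Finset.prod_range_succ, ih, Finset.prod_range_succ',
      Finset.prod_congr rfl fun i _ => ht1 (i + 1) (by omega)]
    simp only [Finset.prod_const, Finset.card_range, Nat.choose_succ_succ' n 1, Nat.choose_one_right]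
    ring

theorem scaledFourTermHankel_mul_det_vandermonde {A : Type*} [CommRing A] [Algebra ℝ A]
    [Nontrivial A] (s t : ℕ → ℝ) (ht : ∀ i, t i ≠ 0) {τ : ℝ} (ht1 : ∀ i, 1 ≤ i → t i = τ)
    (a : Fin 3 → A) (n : ℕ) :
    scaledFourTermHankel s t τ (a 0) (a 1) (a 2) (n + 1) * (vandermonde fun k => -a k).det =
      (-1) ^ (n + 1) * (of fun k j : Fin 3 =>
        (orthPoly (fun i => algebraMap ℝ A (s i)) (fun i => algebraMap ℝ A (t i))
          (n + j + 1)).eval (-a k)).det := by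
  have h := det_hankel_mul_det_vandermonde (s := fun i => algebraMap ℝ A (s i))
    (t := fun i => algebraMap ℝ A (t i)) (m := fun n k => algebraMap ℝ A (pathGF s t n k))
    (fun n => by simp [pathGF_succ_zero]) (fun n k => by simp [pathGF_succ_succ])
    (fun n k h => by simp [pathGF_of_lt s t h]) (fun n => by simp [pathGF_self])
    (fun k => -a k) (n + 1)
  rw [← fourTermHankel_eq_det_momentFunctional] at h
  simp only [← map_prod] at h
  rw [prod_range_prod_range_weights ht1] at h
  have hτ : τ ≠ 0 := ht1 1 le_rfl ▸ ht 1
  have hc : t 0 ^ n * τ ^ n.choose 2 ≠ 0 := mul_ne_zero (pow_ne_zero _ (ht 0)) (pow_ne_zero _ hτ)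
  rw [scaledFourTermHankel, smul_mul_assoc, h, Nat.add_sub_cancel, ← mul_inv, ← mul_smul_comm,
    ← Algebra.smul_def, inv_smul_smul₀ hc]
  have hsign : ((-1 : A) ^ (n + 1 + 3 - 1)) ^ 3 = (-1) ^ (n + 1) := by
    rw [← pow_mul, show (n + 1 + 3 - 1) * 3 = (n + 1) + 2 * (n + 4) by omega, pow_add, pow_mul]
    simp
  simp only [hsign, add_right_comm n 1]

theorem scaledFourTermHankel_recurrence_of_isDomain {A : Type*} [CommRing A] [Algebra ℝ A]
    [IsDomain A] (s t : ℕ → ℝ) (ht : ∀ i, t i ≠ 0) (σ τ : ℝ) (hs1 : ∀ i, 1 ≤ i → s i = σ)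
    (ht1 : ∀ i, 1 ≤ i → t i = τ) (a : Fin 3 → A) (ha : Function.Injective a) :
    SatisfiesLinearRecurrence 8 (scaledFourTermHankel s t τ (a 0) (a 1) (a 2)) := by
  have hτ : τ ≠ 0 := ht1 1 le_rfl ▸ ht 1
  let K := companionKronecker (algebraMap ℝ A τ) (fun k => -a k - algebraMap ℝ A σ)
  have hcard : Fintype.card (Fin 2 × Fin 2 × Fin 2) = 8 := rfl
  -- The factor `(-1) ^ k` absorbs the alternating sign in Christoffel's formula.
  refine ⟨fun k => -((-1) ^ k * K.charpoly.coeff k), ?_, ?_⟩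
  · have h0 : K.charpoly.coeff 0 = algebraMap ℝ A (τ ^ 12) := by
      have h := K.det_eq_sign_charpoly_coeff
      rw [det_companionKronecker, hcard] at h
      rw [map_pow, h]
      norm_num
    simp only [pow_zero, one_mul, h0]
    exact ((isUnit_iff_ne_zero.mpr (pow_ne_zero 12 hτ)).map (algebraMap ℝ A)).neg
  · intro n hn
    obtain ⟨n, rfl⟩ : ∃ l, n = l + 1 := ⟨n - 1, by omega⟩
    have hV : (vandermonde fun k => -a k).det ≠ 0 :=
      det_vandermonde_ne_zero_iff.mpr (neg_injective.comp ha)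
    have h8 : K.charpoly.coeff 8 = 1 := by
      have h := K.charpoly_monic.coeff_natDegree
      rwa [charpoly_natDegree_eq_dim, hcard] at h
    have hrec := sum_charpoly_mul_det (algebraMap ℝ A τ) (fun k => -a k - algebraMap ℝ A σ)
      (fun k n => (orthPoly (fun i => algebraMap ℝ A (s i)) (fun i => algebraMap ℝ A (t i))
        -- The shift by one avoids `s 0` and `t 0`: the coefficients used are `s (n + 2)` and `t (n
        -- + 1)`.
        (n + 1)).eval (-a k)) (fun k n => by
          rw [show n + 2 + 1 = (n + 1) + 2 by ring, orthPoly]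
          simp [hs1 (n + 1 + 1) (by omega), ht1 (n + 1) (by omega)]) n
    refine mul_right_cancel₀ hV ?_
    rw [Finset.sum_range_succ] at hrec
    rw [Finset.sum_mul, add_right_comm n 1 8,
      scaledFourTermHankel_mul_det_vandermonde s t ht ht1 a (n + 8)]
    change _ + K.charpoly.coeff 8 * _ = 0 at hrec
    rw [h8, one_mul] at hrec
    rw [eq_neg_of_add_eq_zero_right hrec, mul_neg, Finset.mul_sum, ← Finset.sum_neg_distrib]
    refine Finset.sum_congr rfl fun k _ => ?_
    rw [mul_assoc, add_right_comm n 1 k, scaledFourTermHankel_mul_det_vandermonde s t ht ht1 a]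
    have hk : (-1 : A) ^ k * (-1) ^ k = 1 := by rw [← mul_pow]; simp
    rw [pow_add, pow_add _ (n + k), pow_add _ n k, pow_add _ n 8]
    change _ = -((-1) ^ k * (companionKronecker _ _).charpoly.coeff k) * _
    linear_combination (-1) ^ n * (companionKronecker (algebraMap ℝ A τ)
      (fun k => -a k - algebraMap ℝ A σ)).charpoly.coeff k * (of fun i j : Fin 3 =>
        (orthPoly (fun i => algebraMap ℝ A (s i)) (fun i => algebraMap ℝ A (t i))
          (n + k + j + 1)).eval (-a i)).det * -hk

end FourTerm

end MotzkinHankel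

theorem corollary7 {A : Type*} [CommRing A] [Algebra ℝ A]
    (s t : ℕ → ℝ) (ht : ∀ i, t i ≠ 0)
    (σ τ : ℝ) (hs1 : ∀ i, 1 ≤ i → s i = σ) (ht1 : ∀ i, 1 ≤ i → t i = τ)
    (α β γ : A) :
    MotzkinHankel.SatisfiesLinearRecurrence 8
      (MotzkinHankel.scaledFourTermHankel s t τ α β γ) := by
  -- The generic recurrence is mapped to `A` by evaluation, which also covers coinciding parameters
  -- and zero divisors.
  obtain ⟨c, hc, h⟩ := MotzkinHankel.scaledFourTermHankel_recurrence_of_isDomain s t ht σ τ hs1 ht1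
    (MvPolynomial.X : Fin 3 → MvPolynomial (Fin 3) ℝ) (MvPolynomial.X_injective)
  let f : MvPolynomial (Fin 3) ℝ →ₐ[ℝ] A := MvPolynomial.aeval ![α, β, γ]
  have hf (n : ℕ) := MotzkinHankel.map_scaledFourTermHankel f s t τ (MvPolynomial.X 0)
    (MvPolynomial.X 1) (MvPolynomial.X 2) n
  have h0 : f (MvPolynomial.X 0) = α := by simp [f]
  have h1 : f (MvPolynomial.X 1) = β := by simp [f]
  have h2 : f (MvPolynomial.X 2) = γ := by simp [f]
  rw [h0, h1, h2] at hf
  refine ⟨fun k => f (c k), hc.map f, fun n hn => ?_⟩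
  simp only [← hf, h n hn, map_sum, map_mul]
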